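/- Let $G=(V,E)$ be a finite, non-empty, connected, planar, trivalent multigraph (loops and multiple edges are allowed, a loop counts twice in the degree, and there are no vertexless circles), and let $\Gamma$ be a plane graph for $G$, that is, a ribbon graph of $G$ (a cyclic ordering of the half-edges at every vertex and a sign for every edge) whose associated closed surface, obtained by gluing discs to all boundary circles, is the sphere. Then $$\dim_{\mathbb C} \widehat{VCH}{}_2^{0}(\Gamma) = 2\cdot \#\{\text{perfect matchings of } G\},$$ where a perfect matching is a set of non-loop edges such that every vertex is incident to exactly one of them, and $\widehat{VCH}{}_2^{*}(\Gamma)$ is the filtered $2$-color vertex homology of $\Gamma$ over $\mathbb C$, which is the case $n=2$ of the following. States and circles: assign to every half-edge of $\Gamma$ a $0$-smoothing (its two strands are parallel) or a $1$-smoothing (its two strands cross). Together with the strands around the corners of the vertices and an additional crossing on every edge of negative sign, this gives a set of immersed circles; when all half-edges are $0$-smoothed, these are the boundary circles of the faces of $\Gamma$. For $\nu\in\{0,1\}^{V}$ let $\Gamma_\nu$ be the state in which the three half-edges at $v$ are $\nu_v$-smoothed, for every $v\in V$. Let $\widehat V=\mathbb C[x]/(x^n-1)$, let $k_\nu$ be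 the number of circles of $\Gamma_\nu$, let $\widehat V_\nu=\widehat V^{\otimes k_\nu}$ with one factor for each circle, and let $\widehat C_n^i(\Gamma)=\bigoplus_{|\nu|=i}\widehat V_\nu$. Differential: put $m=\lfloor n/2\rfloor$. Changing the smoothing of one half-edge from $0$ to $1$ induces the linear map that is the identity on the factors of unaffected circles and, on those of the affected circles, is $x^i\otimes x^j\mapsto x^{i+j}$ if two circles merge, $x^k\mapsto\sum_{0\le i,j<n,\ i+j\equiv k+2m \ (\mathrm{mod}\ n)}x^i\otimes x^j$ if one circle splits into two, and $x^k\mapsto\sqrt n\,x^{k+m}$ if one circle becomes one circle. If $\nu'$ arises from $\nu$ by changing $\nu_v=0$ to $\nu'_v=1$ at a single vertex $v$, then $\widehat\delta_{\nu\nu'}:\widehat V_\nu\to\widehat V_{\nu'}$ is the composition of the maps for the three half-edges at $v$, taken in any order. With respect to a fixed linear order on $V$, $\widehat\delta=\sum_{\nu\to\nu'}(-1)^{\#\{u<v\,:\,\nu_u=1\}}\,\widehat\delta_{\nu\nu'}$, and $\widehat{VCH}{}_n^{i}(\Gamma)$ is the $i$-th cohomology of $(\widehat C_n^{*}(\Gamma),\widehat\delta)$.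 The statement holds for every order on $V$ and for every choice of the orders of the half-edges at the vertices. -/

import Mathlib

open scoped Graph

noncomputable section

namespace VertexHomology

universe u v w

/-! ### Multigraphs -/

/-- A multigraph is connected if it is non-empty and any two vertices are joined by a walk. -/
def IsConnected {V : Type u} {E : Type v} (G : Graph V E) : Prop :=
  V(G).Nonempty ∧ ∀ x ∈ V(G), ∀ y ∈ V(G), Relation.ReflTransGen G.Adj x y

/-- A multigraph is trivalent if every vertex has degree three, a loop counting twice. -/
def IsTrivalent {V : Type u} {E : Type v} (G : Graph V E) : Prop :=
  ∀ x ∈ V(G), (G.incidenceSet x).encard + (G.loopSet x).encard = 3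

/-- A perfect matching is a set of non-loop edges such that every vertex is incident to exactly
one edge of the set. -/
def IsPerfectMatching {V : Type u} {E : Type v} (G : Graph V E) (M : Set E) : Prop :=
  (∀ e ∈ M, e ∈ E(G) ∧ ∀ x, ¬ G.IsLoopAt e x) ∧ ∀ x ∈ V(G), ∃! e, e ∈ M ∧ G.Inc e x

/-! ### Ribbon graphs -/

/-- A ribbon graph of the multigraph `G`, given by a cyclic ordering of the half-edges at every
vertex and a sign for every edge (a signed rotation system). The type of half-edges is `D`; a loop
consists of two distinct half-edges at the same vertex. The surface of the ribbon graph has a disc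
for every vertex and a band for every edge, with a half-twist in the band if `twisted`. -/
structure RibbonGraph {V : Type u} {E : Type v} (G : Graph V E) (D : Type w) where
  /-- the vertex at which a half-edge is attached -/
  vert : D → V
  /-- the edge to which a half-edge belongs -/
  edge : D → E
  /-- the other half of the same edge -/
  opp : D → D
  opp_opp : ∀ d, opp (opp d) = d
  opp_ne : ∀ d, opp d ≠ d
  edge_eq_iff : ∀ d d', edge d = edge d' ↔ d' = d ∨ d' = opp d
  isLink : ∀ d, G.IsLink (edge d) (vert d) (vert (opp d))
  exists_edge : ∀ e ∈ E(G), ∃ d, edge d = e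
  /-- the next half-edge in the cyclic ordering at the vertex -/
  rot : Equiv.Perm D
  /-- the half-edges at a vertex form a single cycle of `rot` -/
  rot_sameCycle : ∀ d d', rot.SameCycle d d' ↔ vert d = vert d'
  /-- the edges with negative sign -/
  twisted : E → Bool

namespace RibbonGraph

variable {V : Type u} {E : Type v} {D : Type w} {G : Graph V E}

/-- A state of the bubbled blowup of `Γ`. The perfect matching edges of the bubbled blowup are the
half-edges of `Γ`; each of them carries its `0`-smoothing (`false`) or its
`1`-smoothing (`true`). -/
abbrev State (_Γ : RibbonGraph G D) : Type w := D → Bool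

/-- The two strands running along the half-edge `d`, seen from its vertex looking outward, are
`(d, true)`, on the side of the next half-edge `rot d`, and `(d, false)`, on the other side.
Two strands are joined around a vertex when they bound the same corner. Along an edge, untwisted
and with both of its halves `0`-smoothed, the strands are parallel, which exchanges the two sides
as the point of view changes to the other end. A negative sign, and each `1`-smoothing of a
half of the edge, makes the two strands cross once. -/
inductive Joined (Γ : RibbonGraph G D) (a : Γ.State) : D × Bool → D × Bool → Prop
  | corner (d : D) : Joined Γ a (d, true) (Γ.rot d, false)
  | along (d : D) (b : Bool) : Joined Γ a (d, b)
      (Γ.opp d, Bool.xor (!b) (Bool.xor (Γ.twisted (Γ.edge d)) (Bool.xor (a d) (a (Γ.opp d)))))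

/-- The immersed circles of a state: the classes of strands that are joined to one another. -/
def Circle (Γ : RibbonGraph G D) (a : Γ.State) : Type w :=
  Quotient (Relation.EqvGen.setoid (Γ.Joined a))

/-- The circle through a given strand. -/
def circle (Γ : RibbonGraph G D) (a : Γ.State) (s : D × Bool) : Γ.Circle a :=
  Quotient.mk _ s

instance (Γ : RibbonGraph G D) (a : Γ.State) [Finite D] : Finite (Γ.Circle a) :=
  inferInstanceAs (Finite (Quotient _))

/-- The faces of `Γ` are the discs glued to the boundary circles of its surface; these are the
circles of the all-zero state. -/
abbrev Face (Γ : RibbonGraph G D) : Type w := Γ.Circle fun _ => false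

/-- A ribbon graph of `G` is a plane graph if `G` is connected and the closed surface obtained by
gluing a disc to every boundary circle is a sphere, that is, it has Euler characteristic two.
(`G` is supposed to have no isolated vertices.) -/
def IsPlane (Γ : RibbonGraph G D) : Prop :=
  IsConnected G ∧ (V(G).ncard : ℤ) - (E(G).ncard : ℤ) + (Nat.card Γ.Face : ℤ) = 2

/-! ### The filtered maps on the hypercube of the bubbled blowup -/

/-- The standard basis of `V̂ ^ ⊗ k`, where `V̂ = ℂ[x] / (x ^ n - 1)` has the basis
`1, x, …, x ^ (n - 1)` and the tensor factors are labelled by the `k` circles of the state `a`: a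
tensor product of monomials is given by the exponent of `x`, modulo `n`, at every circle. -/
abbrev Monomial (Γ : RibbonGraph G D) (n : ℕ) (a : Γ.State) : Type w := Γ.Circle a → ZMod n

open scoped Classical in
/-- The matrix, in the monomial bases, of the filtered map `∂ + ∂~` from the state `a` to the state
`b` that differs from `a` in that the half-edge `d` is `1`-smoothed in `b` and
`0`-smoothed in `a`. It is the identity on the circles that do not run along `d`. On the others
it is, where `m = ⌊n / 2⌋` and exponents are taken modulo `n`, since `x ^ n = 1`,
* `x ^ i ⊗ x ^ j ↦ x ^ (i + j)` if two circles merge into one,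
* `x ^ k ↦ ∑ x ^ i ⊗ x ^ j`, over all `i + j = k + 2 m`, if one circle splits into two,
* `x ^ k ↦ √n x ^ (k + m)` if one circle becomes one circle.
The terms in which the integer exponents (between `0` and `n - 1`) satisfy the stated equality
itself form the part `∂` of degree zero; those in which they satisfy it up to subtracting `n`
form the part `∂~` of degree `n`. -/
def halfEdgeMap (Γ : RibbonGraph G D) (n : ℕ) (d : D) (a b : Γ.State) :
    Matrix (Γ.Monomial n b) (Γ.Monomial n a) ℂ :=
  Matrix.of fun J I =>
    if ∀ s, Γ.circle a s ≠ Γ.circle a (d, false) → Γ.circle a s ≠ Γ.circle a (d, true) →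
        J (Γ.circle b s) = I (Γ.circle a s) then
      if Γ.circle a (d, false) ≠ Γ.circle a (d, true) then
        if J (Γ.circle b (d, false)) = I (Γ.circle a (d, false)) + I (Γ.circle a (d, true))
          then 1 else 0
      else if Γ.circle b (d, false) ≠ Γ.circle b (d, true) then
        if J (Γ.circle b (d, false)) + J (Γ.circle b (d, true)) =
            I (Γ.circle a (d, false)) + ((2 * (n / 2) : ℕ) : ZMod n) then 1 else 0
      else
        if J (Γ.circle b (d, false)) = I (Γ.circle a (d, false)) + ((n / 2 : ℕ) : ZMod n)
          then ((Real.sqrt n : ℝ) : ℂ) else 0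
    else 0

/-! ### The hypercube of vertex states and its filtered complex -/

open scoped Classical in
/-- The state of the bubbled blowup corresponding to the vertex state in which the vertices in `ν`
are `1`-smoothed and the others are `0`-smoothed: a vertex `1`-smoothing is a `1`-smoothing of
all the half-edges at the vertex. -/
def vertexState (Γ : RibbonGraph G D) (ν : Finset V) : Γ.State :=
  fun d => decide (Γ.vert d ∈ ν)

/-- A choice, for every vertex, of the order in which its three half-edges are smoothed, that is,
of one of the six paths of three edges in the hypercube of the bubbled blowup which lead
from the `0`-smoothing to the `1`-smoothing of the vertex. -/
abbrev PathChoice (Γ : RibbonGraph G D) : Type (max u w) :=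
  ∀ x : V(G), Fin 3 ≃ {d : D // Γ.vert d = x}

open scoped Classical in
/-- The matrix of the local filtered map from the vertex state `ν` to the vertex state `ν'` that
differs from it in a `1`-smoothing at `x`: the composition of the maps of the three edges of the
chosen path in the hypercube of the bubbled blowup. -/
def vertexMap [Finite D] (Γ : RibbonGraph G D) (p : Γ.PathChoice) (n : ℕ) [NeZero n]
    (x : V(G)) (ν ν' : Finset V) :
    Matrix (Γ.Monomial n (Γ.vertexState ν')) (Γ.Monomial n (Γ.vertexState ν)) ℂ :=
  letI (a : Γ.State) : Fintype (Γ.Monomial n a) := Fintype.ofFinite _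
  let a₁ : Γ.State := Function.update (Γ.vertexState ν) (p x 0) true
  let a₂ : Γ.State := Function.update a₁ (p x 1) true
  Γ.halfEdgeMap n (p x 2) a₂ (Γ.vertexState ν') * Γ.halfEdgeMap n (p x 1) a₁ a₂ *
    Γ.halfEdgeMap n (p x 0) (Γ.vertexState ν) a₁

/-- The standard basis of the chain group of degree `i`, the direct sum over the vertex states with
exactly `i` vertices `1`-smoothed of the spaces `V̂ ^ ⊗ k`, where `k` is the number of circles. -/
abbrev Generator (Γ : RibbonGraph G D) (n : ℕ) (i : ℤ) : Type (max u w) :=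
  Σ ν : {ν : Finset V // (ν : Set V) ⊆ V(G) ∧ (ν.card : ℤ) = i}, Γ.Monomial n (Γ.vertexState ν.1)

/-- The chain group of degree `i` of the filtered complex, in coordinates with respect to its
standard basis. It is zero unless `0 ≤ i ≤ |V|`. -/
abbrev Chain (Γ : RibbonGraph G D) (n : ℕ) (i : ℤ) : Type (max u w) := Γ.Generator n i → ℂ

open scoped Classical in
/-- The filtered differential from degree `i` to degree `j`, meant for `j = i + 1`: the signed sum
of the local maps over the edges of the hypercube of vertex states. The sign is given by the
parity of the number of `1`-smoothed vertices that precede the vertex being changed. -/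
def differential [Fintype V] [LinearOrder V] [Finite D] (Γ : RibbonGraph G D) (p : Γ.PathChoice)
    (n : ℕ) [NeZero n] (i j : ℤ) : Γ.Chain n i →ₗ[ℂ] Γ.Chain n j :=
  letI : Fintype (Γ.Generator n i) := Fintype.ofFinite _
  Matrix.mulVecLin <| Matrix.of fun (g' : Γ.Generator n j) (g : Γ.Generator n i) =>
    ∑ x : V(G), if (x : V) ∉ g.1.1 ∧ g'.1.1 = insert (x : V) g.1.1 then
      (-1 : ℂ) ^ (g.1.1.filter fun y => y < (x : V)).card *
        Γ.vertexMap p n x g.1.1 g'.1.1 g'.2 g.2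
    else 0

/-- The filtered `n`-color vertex homology in degree `i`: the kernel of the outgoing differential
modulo the image of the incoming one. (The square of the differential is zero; so that this need
not be known in order to form the quotient, the image is intersected with the kernel.) -/
abbrev FilteredVertexHomology [Fintype V] [LinearOrder V] [Finite D] (Γ : RibbonGraph G D)
    (p : Γ.PathChoice) (n : ℕ) [NeZero n] (i : ℤ) : Type (max u w) :=
  LinearMap.ker (Γ.differential p n i (i + 1)) ⧸
    (LinearMap.range (Γ.differential p n (i - 1) i)).submoduleOf
      (LinearMap.ker (Γ.differential p n i (i + 1)))

end RibbonGraph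

end VertexHomology

end

/-!
For `n` arbitrary, the characters of `(ℤ/n)^k` form a basis of the functions on the monomials of a
state with `k` circles, and they correspond to the colorings of its circles with the colors `ℤ/n`.
In this basis the half-edge maps are diagonal: the map at `d` kills a coloring with different
colors on the two strands along `d`, and otherwise sends it to a nonzero multiple of the same
coloring of the strands. Hence the map at a vertex kills the colorings which are not monochromatic
along some half-edge at this vertex and is injective on the span of the others, so that the homology
in degree zero has a basis consisting of the colorings of the faces for which no vertex is
monochromatic.

Now let `n = 2`. Since the differences of colors across the three half-edges at a vertex add up to
zero, a vertex is not monochromatic if and only if exactly one of its half-edges has the same color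
on both sides; the edges with the same color on both sides then form a perfect matching.
The complement of a perfect matching of a trivalent graph is a cycle modulo two. On the sphere it
bounds exactly two complementary sets of faces, that is, it comes from exactly two colorings.
-/

open scoped Graph Matrix

noncomputable section

namespace VertexHomology

universe u v w

lemma even_card_of_involutive {α : Type*} {s : Finset α} {f : α → α} (hf : f.Involutive)
    (hne : ∀ x ∈ s, f x ≠ x) (hs : ∀ x ∈ s, f x ∈ s) : Even s.card := by
  have h_sum : ∑ _x ∈ s, (1 : ZMod 2) = 0 :=
    Finset.sum_involution (fun x _ => f x) (fun _ _ => CharTwo.add_self_eq_zero _)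
      (fun x hx _ => hne x hx) hs (fun x _ => hf x)
  rw [← ZMod.natCast_eq_zero_iff_even, Finset.cast_card, h_sum]

lemma ker_eq_span_image_compl {ι R M M' : Type*} [Ring R] [AddCommGroup M] [Module R M]
    [AddCommGroup M'] [Module R M'] (b : Module.Basis ι R M) {f : M →ₗ[R] M'} {s : Set ι}
    (h_zero : ∀ i ∉ s, f (b i) = 0) (h_ind : LinearIndepOn R (f ∘ b) s) :
    f.ker = Submodule.span R (b '' sᶜ) := by
  classical
  refine le_antisymm (fun v hv => ?_) (Submodule.span_le.2 (Set.image_subset_iff.2 h_zero))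
  have h_compl : Finsupp.linearCombination R (f ∘ b) ((b.repr v).filter (· ∉ s)) = 0 :=
    Finset.sum_eq_zero fun i hi => by simp [h_zero i (Finset.mem_filter.1 hi).2]
  have h_comb : Finsupp.linearCombination R (f ∘ b) ((b.repr v).filter (· ∈ s)) = 0 := by
    have h_add : Finsupp.linearCombination R (f ∘ b) ((b.repr v).filter (· ∈ s)) +
        Finsupp.linearCombination R (f ∘ b) ((b.repr v).filter (· ∉ s)) = f v := by
      rw [← map_add, Finsupp.filter_add_filter_not, ← Finsupp.apply_linearCombination,
        b.linearCombination_repr]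
    rwa [h_compl, add_zero, LinearMap.mem_ker.1 hv] at h_add
  have h_filter := linearIndepOn_iff.1 h_ind _
    ((Finsupp.mem_supported _ _).2 fun i hi => (Finset.mem_filter.1 hi).2) h_comb
  refine b.mem_span_image.2 fun i hi his => Finsupp.mem_support_iff.1 hi ?_
  rw [← Finsupp.filter_apply_pos (· ∈ s) _ his, h_filter, Finsupp.zero_apply]

lemma iInf_ker_eq_span_image {ι X R M : Type*} {M' : X → Type*} [Ring R] [AddCommGroup M]
    [Module R M] [∀ x, AddCommGroup (M' x)] [∀ x, Module R (M' x)] (b : Module.Basis ι R M)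
    {f : ∀ x, M →ₗ[R] M' x} {s : X → Set ι} (h_zero : ∀ x, ∀ i ∉ s x, f x (b i) = 0)
    (h_ind : ∀ x, LinearIndepOn R (f x ∘ b) (s x)) :
    ⨅ x, (f x).ker = Submodule.span R (b '' {i | ∀ x, i ∉ s x}) := by
  ext v
  simp only [Submodule.mem_iInf, ker_eq_span_image_compl b (h_zero _) (h_ind _),
    b.mem_span_image, Set.subset_def, Set.mem_compl_iff, Set.mem_ofPred_eq]
  tauto

lemma IsConnected.apply_eq_apply {V : Type u} {E : Type v} {G : Graph V E} (hG : IsConnected G)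
    {α : Type*} {f : V(G) → α} (hf : ∀ x y : V(G), G.Adj x y → f x = f y) (x y : V(G)) :
    f x = f y := by
  suffices h : ∀ z, Relation.ReflTransGen G.Adj x z → ∀ hz : z ∈ V(G), f x = f ⟨z, hz⟩ from
    h y (hG.2 x x.2 y y.2) y.2
  intro z hxz
  induction hxz with
  | refl => exact fun _ => rfl
  | tail _ h_adj ih =>
    exact fun hz => (ih h_adj.left_mem).trans (hf ⟨_, h_adj.left_mem⟩ ⟨_, hz⟩ h_adj)

namespace RibbonGraph

variable {V : Type u} {E : Type v} {D : Type w} {G : Graph V E}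

/-! ### Changing the smoothing of one half-edge -/

section Smoothing

variable {Γ : RibbonGraph G D} {a b : Γ.State} {d : D} {s t : D × Bool}

lemma edge_opp (Γ : RibbonGraph G D) (d : D) : Γ.edge (Γ.opp d) = Γ.edge d :=
  ((Γ.edge_eq_iff d (Γ.opp d)).2 (.inr rfl)).symm

/-- The strand in which `s` continues along its edge, in the state `a`. -/
def across (Γ : RibbonGraph G D) (a : Γ.State) (s : D × Bool) : D × Bool :=
  (Γ.opp s.1, Bool.xor (!s.2)
    (Bool.xor (Γ.twisted (Γ.edge s.1)) (Bool.xor (a s.1) (a (Γ.opp s.1)))))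

lemma across_involutive (Γ : RibbonGraph G D) (a : Γ.State) : (Γ.across a).Involutive := by
  rintro ⟨d, β⟩
  simp only [across, Γ.opp_opp, edge_opp, Prod.mk.injEq, true_and]
  cases β <;> cases Γ.twisted (Γ.edge d) <;> cases a d <;> cases a (Γ.opp d) <;> rfl

lemma across_ne (Γ : RibbonGraph G D) (a : Γ.State) (s : D × Bool) : Γ.across a s ≠ s :=
  fun h => Γ.opp_ne s.1 (congrArg Prod.fst h)

/-- The strand in which `s` continues around the corner of its vertex. -/
def around (Γ : RibbonGraph G D) (s : D × Bool) : D × Bool :=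
  if s.2 then (Γ.rot s.1, false) else (Γ.rot.symm s.1, true)

lemma around_involutive (Γ : RibbonGraph G D) : Γ.around.Involutive := by
  rintro ⟨d, _ | _⟩ <;> simp [around]

lemma around_ne (Γ : RibbonGraph G D) (s : D × Bool) : Γ.around s ≠ s := by
  obtain ⟨d, _ | _⟩ := s <;> simp [around]

lemma circle_surjective (Γ : RibbonGraph G D) (a : Γ.State) :
    Function.Surjective (Γ.circle a) :=
  Quotient.mk_surjective

lemma circle_eq_of_joined (h : Γ.Joined a s t) : Γ.circle a s = Γ.circle a t :=
  Quotient.sound (.rel _ _ h)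

lemma circle_corner (Γ : RibbonGraph G D) (a : Γ.State) (d : D) :
    Γ.circle a (d, true) = Γ.circle a (Γ.rot d, false) :=
  circle_eq_of_joined (.corner d)

lemma circle_across (Γ : RibbonGraph G D) (a : Γ.State) (s : D × Bool) :
    Γ.circle a (Γ.across a s) = Γ.circle a s :=
  (circle_eq_of_joined (.along s.1 s.2)).symm

lemma circle_around (Γ : RibbonGraph G D) (a : Γ.State) (s : D × Bool) :
    Γ.circle a (Γ.around s) = Γ.circle a s := by
  obtain ⟨d, _ | _⟩ := s
  · simpa [around] using Γ.circle_corner a (Γ.rot.symm d)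
  · exact (Γ.circle_corner a d).symm

lemma rel_of_circle_eq {r : D × Bool → D × Bool → Prop} (hr : Equivalence r)
    (h_corner : ∀ d, r (d, true) (Γ.rot d, false)) (h_across : ∀ s, r s (Γ.across a s))
    (hst : Γ.circle a s = Γ.circle a t) : r s t := by
  refine hr.eqvGen_iff.1 (Relation.EqvGen.mono ?_ _ _ (Quotient.exact hst))
  rintro _ _ (d | ⟨d, β⟩)
  exacts [h_corner d, h_across (d, β)]

/-- The states `a` and `b` differ exactly in the smoothing of the half-edge `d`. -/
def DiffersAt (Γ : RibbonGraph G D) (a b : Γ.State) (d : D) : Prop :=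
  b d = !a d ∧ ∀ d', d' ≠ d → b d' = a d'

lemma DiffersAt.symm (h : Γ.DiffersAt a b d) : Γ.DiffersAt b a d :=
  ⟨by simp [h.1], fun d' hd' => (h.2 d' hd').symm⟩

lemma DiffersAt.across_eq (h : Γ.DiffersAt a b d) (h₁ : s.1 ≠ d) (h₂ : Γ.opp s.1 ≠ d) :
    Γ.across b s = Γ.across a s := by
  simp only [across, h.2 _ h₁, h.2 _ h₂]

lemma DiffersAt.across_self (h : Γ.DiffersAt a b d) (β : Bool) :
    Γ.across b (d, β) = Γ.across a (d, !β) := by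
  simp only [across, h.1, h.2 _ (Γ.opp_ne d), Prod.mk.injEq, true_and]
  cases β <;> cases Γ.twisted (Γ.edge d) <;> cases a d <;> cases a (Γ.opp d) <;> rfl

open scoped Classical in
/-- The set of the one or two circles of the state `a` that run along the half-edge `d`, the only
ones affected by a change of its smoothing. -/
def circlesAlong (Γ : RibbonGraph G D) (a : Γ.State) (d : D) : Finset (Γ.Circle a) :=
  {Γ.circle a (d, false), Γ.circle a (d, true)}

lemma mem_circlesAlong {c : Γ.Circle a} :
    c ∈ Γ.circlesAlong a d ↔ c = Γ.circle a (d, false) ∨ c = Γ.circle a (d, true) := by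
  simp [circlesAlong]

lemma circle_self_mem_circlesAlong (Γ : RibbonGraph G D) (a : Γ.State) (d : D) (β : Bool) :
    Γ.circle a (d, β) ∈ Γ.circlesAlong a d := by
  cases β <;> simp [circlesAlong]

lemma DiffersAt.circle_across_eq_or_mem (h : Γ.DiffersAt a b d) (s : D × Bool) :
    Γ.circle b s = Γ.circle b (Γ.across a s) ∨
      Γ.circle b s ∈ Γ.circlesAlong b d ∧ Γ.circle b (Γ.across a s) ∈ Γ.circlesAlong b d := by
  obtain ⟨d', β⟩ := s
  by_cases h₁ : d' = d
  · subst h₁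
    rw [h.symm.across_self, circle_across]
    exact .inr ⟨circle_self_mem_circlesAlong .., circle_self_mem_circlesAlong ..⟩
  by_cases h₂ : Γ.opp d' = d
  · subst h₂
    rw [← Γ.circle_across b (d', β)]
    exact .inr ⟨circle_self_mem_circlesAlong .., circle_self_mem_circlesAlong ..⟩
  · rw [← h.across_eq h₁ h₂, circle_across]
    exact .inl rfl

lemma DiffersAt.circle_eq_or_mem (h : Γ.DiffersAt a b d) (hst : Γ.circle a s = Γ.circle a t) :
    Γ.circle b s = Γ.circle b t ∨
      Γ.circle b s ∈ Γ.circlesAlong b d ∧ Γ.circle b t ∈ Γ.circlesAlong b d := by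
  refine rel_of_circle_eq (r := fun s t => Γ.circle b s = Γ.circle b t ∨
    Γ.circle b s ∈ Γ.circlesAlong b d ∧ Γ.circle b t ∈ Γ.circlesAlong b d)
    ⟨fun _ => .inl rfl, ?_, ?_⟩ (fun d' => .inl (Γ.circle_corner b d'))
    h.circle_across_eq_or_mem hst
  · rintro s t (h | h)
    exacts [.inl h.symm, .inr h.symm]
  · rintro s t r (h | h) (h' | h')
    · exact .inl (h.trans h')
    · exact .inr ⟨h ▸ h'.1, h'.2⟩
    · exact .inr ⟨h.1, h' ▸ h.2⟩
    · exact .inr ⟨h.1, h'.2⟩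

lemma DiffersAt.circle_mem_circlesAlong_iff (h : Γ.DiffersAt a b d) (s : D × Bool) :
    Γ.circle a s ∈ Γ.circlesAlong a d ↔ Γ.circle b s ∈ Γ.circlesAlong b d := by
  suffices ∀ {a b : Γ.State}, Γ.DiffersAt a b d → Γ.circle a s ∈ Γ.circlesAlong a d →
      Γ.circle b s ∈ Γ.circlesAlong b d from ⟨this h, this h.symm⟩
  intro a b h hs
  obtain ⟨β, hs⟩ : ∃ β, Γ.circle a s = Γ.circle a (d, β) :=
    (mem_circlesAlong.1 hs).elim (⟨_, ·⟩) (⟨_, ·⟩)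
  obtain h_eq | h_mem := h.circle_eq_or_mem hs
  · exact h_eq ▸ circle_self_mem_circlesAlong ..
  · exact h_mem.1

lemma DiffersAt.circle_eq_iff (h : Γ.DiffersAt a b d) (ht : Γ.circle a t ∉ Γ.circlesAlong a d) :
    Γ.circle a s = Γ.circle a t ↔ Γ.circle b s = Γ.circle b t :=
  ⟨fun hs => (h.circle_eq_or_mem hs).resolve_right fun h' =>
    ht ((h.circle_mem_circlesAlong_iff t).2 h'.2),
    fun hs => (h.symm.circle_eq_or_mem hs).resolve_right fun h' => ht h'.2⟩

lemma DiffersAt.across_eq_of_circle_ne (h : Γ.DiffersAt a b d)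
    (ha : Γ.circle a (d, false) ≠ Γ.circle a (d, true))
    (hb : Γ.circle b (d, false) ≠ Γ.circle b (d, true)) (hs : s ≠ (d, false))
    (hsa : Γ.circle a s = Γ.circle a (d, false)) (hsb : Γ.circle b s = Γ.circle b (d, false)) :
    Γ.across b s = Γ.across a s := by
  obtain ⟨d', β⟩ := s
  refine h.across_eq ?_ fun hd => ?_
  · rintro rfl
    cases β
    exacts [hs rfl, ha hsa.symm]
  · obtain ⟨γ, hγ⟩ : ∃ γ, Γ.across a (d', β) = (d, γ) := ⟨_, Prod.ext hd rfl⟩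
    have hγ' : (d', β) = Γ.across b (d, !γ) := by
      rw [h.across_self, Bool.not_not, ← hγ, across_involutive]
    rw [← circle_across, hγ] at hsa
    rw [hγ', circle_across] at hsb
    cases γ
    exacts [hb hsb.symm, ha hsa.symm]

lemma DiffersAt.circle_eq_of_circle_ne [Finite D] (h : Γ.DiffersAt a b d)
    (ha : Γ.circle a (d, false) ≠ Γ.circle a (d, true)) :
    Γ.circle b (d, false) = Γ.circle b (d, true) := by
  classical
  have := Fintype.ofFinite D
  by_contra hb
  -- Otherwise the strands on the circle of `(d, false)` in both states are paired by `around`, and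
  -- all but `(d, false)` itself are paired by `across`: their number is both even and odd.
  let T : Finset (D × Bool) := {s | Γ.circle a s = Γ.circle a (d, false) ∧
    Γ.circle b s = Γ.circle b (d, false)}
  have mem_T (s) : s ∈ T ↔
      Γ.circle a s = Γ.circle a (d, false) ∧ Γ.circle b s = Γ.circle b (d, false) := by simp [T]
  have h_even : Even T.card :=
    even_card_of_involutive Γ.around_involutive (fun s _ => Γ.around_ne s)
      (fun s hs => by simpa only [mem_T, circle_around] using hs)
  have h_odd : Even (T.erase (d, false)).card := by
    refine even_card_of_involutive (Γ.across_involutive a) (fun s _ => Γ.across_ne a s)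
      fun s hs => ?_
    obtain ⟨hs₀, hs⟩ := Finset.mem_erase.1 hs
    rw [mem_T] at hs
    have h_across := h.across_eq_of_circle_ne ha hb hs₀ hs.1 hs.2
    refine Finset.mem_erase.2 ⟨fun h₀ => ?_, (mem_T _).2 ⟨?_, ?_⟩⟩
    · rw [h₀] at h_across
      have hs' : s = Γ.across b (d, false) := by rw [← h_across, across_involutive]
      have hs'' : s = Γ.across a (d, false) := by rw [← h₀, across_involutive]
      rw [hs'', h.across_self] at hs'
      simpa using (Γ.across_involutive a).injective hs'
    · rw [circle_across, hs.1]
    · rw [← h_across, circle_across, hs.2]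
  rw [← Finset.card_erase_add_one ((mem_T (d, false)).2 ⟨rfl, rfl⟩)] at h_even
  exact Nat.not_even_iff_odd.2 h_odd.add_one h_even

end Smoothing

/-! ### Characters given by colorings -/

section Coloring

variable {X : Type*} [Fintype X] {n : ℕ} [NeZero n]

/-- The character of the group of exponents of monomials given by a coloring `g`. Up to scalars,
these characters are the primitive idempotents of `(ℂ[x] / (x ^ n - 1)) ^ ⊗ X`, written in the
basis of monomials. -/
def coloringChar (g : X → ZMod n) : AddChar (X → ZMod n) ℂ where
  toFun I := ZMod.stdAddChar (g ⬝ᵥ I)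
  map_zero_eq_one' := by rw [dotProduct_zero, AddChar.map_zero_eq_one]
  map_add_eq_mul' I J := by rw [dotProduct_add, AddChar.map_add_eq_mul]

lemma coloringChar_apply (g I : X → ZMod n) : coloringChar g I = ZMod.stdAddChar (g ⬝ᵥ I) := rfl

lemma coloringChar_single_one [DecidableEq X] (g : X → ZMod n) (c : X) :
    coloringChar g (Pi.single c 1) = ZMod.stdAddChar (g c) := by
  rw [coloringChar_apply, dotProduct_single, mul_one]

lemma coloringChar_injective : Function.Injective (coloringChar (X := X) (n := n)) := by
  classical
  intro g g' h
  funext c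
  apply ZMod.injective_stdAddChar
  rw [← coloringChar_single_one, h, coloringChar_single_one]

lemma linearIndependent_coloringChar (X : Type*) [Fintype X] (n : ℕ) [NeZero n] :
    LinearIndependent ℂ fun g : X → ZMod n => (coloringChar g : (X → ZMod n) → ℂ) :=
  (AddChar.linearIndependent (X → ZMod n) ℂ).comp _ coloringChar_injective

/-- The basis of all functions of exponents that consists of the characters given by colorings. -/
def coloringBasis (X : Type*) [Fintype X] (n : ℕ) [NeZero n] :
    Module.Basis (X → ZMod n) ℂ ((X → ZMod n) → ℂ) :=
  .mk (linearIndependent_coloringChar X n) <| by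
    classical
    exact ((linearIndependent_coloringChar X n).span_eq_top_of_card_eq_finrank'
      (Module.finrank_fintype_fun_eq_card ℂ).symm).ge

lemma coloringBasis_apply (g : X → ZMod n) : coloringBasis X n g = coloringChar g :=
  Module.Basis.mk_apply _ _ g

lemma eq_smul_coloringChar [DecidableEq X] {g : X → ZMod n} {v : (X → ZMod n) → ℂ}
    (hv : ∀ c I, v (I + Pi.single c 1) = ZMod.stdAddChar (g c) * v I) :
    v = v 0 • coloringChar g := by
  suffices h : ∀ I J, v (J + I) = coloringChar g I * v J by
    funext I
    rw [Pi.smul_apply, smul_eq_mul, mul_comm, ← h I 0, zero_add]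
  intro I
  induction I using Pi.single_induction with
  | zero => simp [AddChar.map_zero_eq_one]
  | add I I' hI hI' =>
    intro J
    rw [← add_assoc, hI', hI, AddChar.map_add_eq_mul]
    ring
  | single c k =>
    rw [← ZMod.natCast_zmod_val k]
    induction k.val with
    | zero => simp [AddChar.map_zero_eq_one]
    | succ k ih =>
      intro J
      rw [Nat.cast_succ, Pi.single_add, ← add_assoc, hv, ih, AddChar.map_add_eq_mul,
        coloringChar_single_one]
      ring

end Coloring

/-! ### Half-edge maps are diagonal in the basis of characters -/

instance [Finite D] (Γ : RibbonGraph G D) (a : Γ.State) : Fintype (Γ.Circle a) :=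
  Fintype.ofFinite _

instance [Finite D] (Γ : RibbonGraph G D) (n : ℕ) [NeZero n] (a : Γ.State) :
    Fintype (Γ.Monomial n a) :=
  Fintype.ofFinite _

section HalfEdgeMap

variable {Γ : RibbonGraph G D} {n : ℕ} {a b : Γ.State} {d : D} {s : D × Bool}

lemma sum_circlesAlong_of_circle_eq (h : Γ.circle a (d, false) = Γ.circle a (d, true))
    (I : Γ.Monomial n a) : ∑ c ∈ Γ.circlesAlong a d, I c = I (Γ.circle a (d, false)) := by
  classical rw [circlesAlong, ← h, Finset.pair_eq_singleton, Finset.sum_singleton]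

lemma sum_circlesAlong_of_circle_ne (h : Γ.circle a (d, false) ≠ Γ.circle a (d, true))
    (I : Γ.Monomial n a) : ∑ c ∈ Γ.circlesAlong a d, I c =
      I (Γ.circle a (d, false)) + I (Γ.circle a (d, true)) := by
  classical exact Finset.sum_pair h

/-- The exponents of `x` away from `d` agree for `I` and `J`, and the total exponent on the circles
along `d` is increased by `k`. The terms of a half-edge map are all of this form, whether it merges
circles, splits one, or neither. -/
def ShiftsAlong (Γ : RibbonGraph G D) {a b : Γ.State} (d : D) (k : ZMod n) (J : Γ.Monomial n b)
    (I : Γ.Monomial n a) : Prop :=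
  (∀ s, Γ.circle a s ∉ Γ.circlesAlong a d → J (Γ.circle b s) = I (Γ.circle a s)) ∧
    ∑ c ∈ Γ.circlesAlong b d, J c = ∑ c ∈ Γ.circlesAlong a d, I c + k

open scoped Classical in
lemma DiffersAt.exists_halfEdgeMap_eq [Finite D] [NeZero n] (h : Γ.DiffersAt a b d) :
    ∃ (k : ZMod n) (w : ℂ), w ≠ 0 ∧
      Γ.halfEdgeMap n d a b = Matrix.of fun J I => if Γ.ShiftsAlong d k J I then w else 0 := by
  have h_sqrt : ((√n : ℝ) : ℂ) ≠ 0 := by simp [NeZero.ne n]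
  simp only [halfEdgeMap, ShiftsAlong, ite_and, mem_circlesAlong, not_or, and_imp]
  by_cases ha : Γ.circle a (d, false) = Γ.circle a (d, true)
  · by_cases hb : Γ.circle b (d, false) = Γ.circle b (d, true)
    · refine ⟨(n / 2 : ℕ), _, h_sqrt, ?_⟩
      simp only [sum_circlesAlong_of_circle_eq ha, sum_circlesAlong_of_circle_eq hb,
        if_neg (not_not_intro ha), if_neg (not_not_intro hb), ne_eq]
    · refine ⟨(2 * (n / 2) : ℕ), 1, one_ne_zero, ?_⟩
      simp only [sum_circlesAlong_of_circle_eq ha, sum_circlesAlong_of_circle_ne hb,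
        if_neg (not_not_intro ha), if_pos hb, ne_eq]
  · have hb := h.circle_eq_of_circle_ne ha
    refine ⟨0, 1, one_ne_zero, ?_⟩
    simp only [sum_circlesAlong_of_circle_ne ha, sum_circlesAlong_of_circle_eq hb, if_pos ha,
      add_zero, ne_eq]

open scoped Classical in
lemma DiffersAt.shiftsAlong_add_single (h : Γ.DiffersAt a b d) (k : ZMod n)
    (J : Γ.Monomial n b) (I : Γ.Monomial n a) (s : D × Bool) :
    Γ.ShiftsAlong d k (J + Pi.single (Γ.circle b s) 1) (I + Pi.single (Γ.circle a s) 1) ↔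
      Γ.ShiftsAlong d k J I := by
  refine and_congr (forall₂_congr fun t ht => ?_) ?_
  · simp only [Pi.add_apply, Pi.single_apply, eq_comm (b := Γ.circle _ s), h.circle_eq_iff ht,
      add_left_inj]
  · simp only [Pi.add_apply, Finset.sum_add_distrib, Finset.sum_pi_single',
      h.circle_mem_circlesAlong_iff s, add_right_comm _ _ k, add_left_inj]

/-- The coloring `g` of circles gives the same color to both sides of the half-edge `d`. -/
def MonochromaticAlong {α : Type*} (g : Γ.Circle a → α) (d : D) : Prop :=
  g (Γ.circle a (d, false)) = g (Γ.circle a (d, true))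

lemma MonochromaticAlong.eq_of_mem_circlesAlong {α : Type*} {g : Γ.Circle a → α}
    (hg : MonochromaticAlong g d) {c : Γ.Circle a} (hc : c ∈ Γ.circlesAlong a d) :
    g c = g (Γ.circle a (d, false)) := by
  obtain rfl | rfl := mem_circlesAlong.1 hc
  exacts [rfl, hg.symm]

lemma monochromaticAlong_congr {α : Type*} {g : Γ.Circle a → α} {g' : Γ.Circle b → α}
    (h : ∀ s, g' (Γ.circle b s) = g (Γ.circle a s)) (d : D) :
    MonochromaticAlong g' d ↔ MonochromaticAlong g d := by
  simp only [MonochromaticAlong, h]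

lemma DiffersAt.exists_forall_circle_eq {α : Type*} (h : Γ.DiffersAt a b d) {g : Γ.Circle a → α}
    (hg : MonochromaticAlong g d) :
    ∃ g' : Γ.Circle b → α, ∀ s, g' (Γ.circle b s) = g (Γ.circle a s) := by
  have h_const (s t) (hst : Γ.circle b s = Γ.circle b t) :
      g (Γ.circle a s) = g (Γ.circle a t) :=
    (h.symm.circle_eq_or_mem hst).elim (congrArg g) fun hst' => by
      rw [hg.eq_of_mem_circlesAlong hst'.1, hg.eq_of_mem_circlesAlong hst'.2]
  exact ⟨Quotient.lift (g ∘ Γ.circle a) fun s t hst => h_const s t (Quotient.sound hst),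
    fun _ => rfl⟩

variable [Finite D] [NeZero n]

open scoped Classical in
lemma DiffersAt.halfEdgeMap_mulVec_add_single (h : Γ.DiffersAt a b d) (g : Γ.Circle a → ZMod n)
    (J : Γ.Monomial n b) (s : D × Bool) :
    (Γ.halfEdgeMap n d a b *ᵥ coloringChar g) (J + Pi.single (Γ.circle b s) 1) =
      ZMod.stdAddChar (g (Γ.circle a s)) * (Γ.halfEdgeMap n d a b *ᵥ coloringChar g) J := by
  obtain ⟨k, w, -, h_eq⟩ := h.exists_halfEdgeMap_eq (n := n)
  simp only [h_eq, Matrix.mulVec, dotProduct, Matrix.of_apply, Finset.mul_sum]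
  rw [← Equiv.sum_comp (Equiv.addRight (Pi.single (Γ.circle a s) 1))]
  refine Finset.sum_congr rfl fun I _ => ?_
  rw [Equiv.coe_addRight, h.shiftsAlong_add_single, AddChar.map_add_eq_mul,
    coloringChar_single_one]
  ring

lemma DiffersAt.halfEdgeMap_mulVec_eq_zero (h : Γ.DiffersAt a b d) {g : Γ.Circle a → ZMod n}
    (hg : ¬ MonochromaticAlong g d) :
    Γ.halfEdgeMap n d a b *ᵥ coloringChar g = 0 := by
  classical
  have hb := h.circle_eq_of_circle_ne fun ha => hg (congrArg g ha)
  funext J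
  have h_char := h.halfEdgeMap_mulVec_add_single g J (d, false)
  rw [hb, h.halfEdgeMap_mulVec_add_single] at h_char
  by_contra hJ
  exact hg (ZMod.injective_stdAddChar (mul_right_cancel₀ hJ h_char)).symm

lemma coloringChar_eq_of_shiftsAlong {g : Γ.Circle a → ZMod n} (hg : MonochromaticAlong g d)
    {k : ZMod n} {I : Γ.Monomial n a} (hI : Γ.ShiftsAlong d k (0 : Γ.Monomial n b) I) :
    coloringChar g I = ZMod.stdAddChar (-(g (Γ.circle a (d, false)) * k)) := by
  have h_sum : ∑ c ∈ Γ.circlesAlong a d, I c = -k := by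
    rw [eq_neg_iff_add_eq_zero, ← hI.2]
    exact Finset.sum_const_zero
  have h_dot : g ⬝ᵥ I = ∑ c ∈ Γ.circlesAlong a d, g c * I c := by
    refine (Finset.sum_subset (Finset.subset_univ _) fun c _ hc => ?_).symm
    obtain ⟨s, rfl⟩ := Γ.circle_surjective a c
    rw [← hI.1 s hc, Pi.zero_apply, mul_zero]
  have h_const : ∑ c ∈ Γ.circlesAlong a d, g c * I c = g (Γ.circle a (d, false)) * -k := by
    rw [← h_sum, Finset.mul_sum]
    exact Finset.sum_congr rfl fun c hc => by rw [hg.eq_of_mem_circlesAlong hc]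
  rw [coloringChar_apply, h_dot, h_const, mul_neg]

lemma DiffersAt.halfEdgeMap_mulVec_apply_zero_ne_zero (h : Γ.DiffersAt a b d)
    {g : Γ.Circle a → ZMod n} (hg : MonochromaticAlong g d) :
    (Γ.halfEdgeMap n d a b *ᵥ coloringChar g) 0 ≠ 0 := by
  classical
  obtain ⟨k, w, hw, h_eq⟩ := h.exists_halfEdgeMap_eq (n := n)
  have h_witness : Γ.ShiftsAlong d k (0 : Γ.Monomial n b)
      (Pi.single (Γ.circle a (d, false)) (-k) : Γ.Monomial n a) := by
    refine ⟨fun s hs => ?_, ?_⟩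
    · rw [Pi.zero_apply, Pi.single_eq_of_ne]
      exact fun hs' => hs (hs' ▸ circle_self_mem_circlesAlong ..)
    · rw [Finset.sum_pi_single', if_pos (circle_self_mem_circlesAlong ..), neg_add_cancel]
      exact Finset.sum_const_zero
  have h_term (I : Γ.Monomial n a) :
      (if Γ.ShiftsAlong d k (0 : Γ.Monomial n b) I then w else 0) * coloringChar g I =
        if Γ.ShiftsAlong d k (0 : Γ.Monomial n b) I then
          w * ZMod.stdAddChar (-(g (Γ.circle a (d, false)) * k)) else 0 := by
    split_ifs with hI
    · rw [coloringChar_eq_of_shiftsAlong hg hI]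
    · rw [zero_mul]
  simp only [h_eq, Matrix.mulVec, dotProduct, Matrix.of_apply, h_term]
  rw [← Finset.sum_filter, Finset.sum_const, nsmul_eq_mul]
  refine mul_ne_zero (Nat.cast_ne_zero.2 (Finset.card_ne_zero.2 ⟨_, Finset.mem_filter.2
    ⟨Finset.mem_univ _, h_witness⟩⟩)) (mul_ne_zero hw (AddChar.val_isUnit _ _).ne_zero)

lemma DiffersAt.exists_halfEdgeMap_mulVec_eq_smul (h : Γ.DiffersAt a b d)
    {g : Γ.Circle a → ZMod n} (hg : MonochromaticAlong g d) :
    ∃ z : ℂ, z ≠ 0 ∧ ∃ g' : Γ.Circle b → ZMod n, (∀ s, g' (Γ.circle b s) = g (Γ.circle a s)) ∧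
      Γ.halfEdgeMap n d a b *ᵥ coloringChar g = z • coloringChar g' := by
  classical
  obtain ⟨g', hg'⟩ := h.exists_forall_circle_eq hg
  refine ⟨_, h.halfEdgeMap_mulVec_apply_zero_ne_zero hg, g', hg',
    eq_smul_coloringChar fun c J => ?_⟩
  obtain ⟨s, rfl⟩ := Γ.circle_surjective b c
  rw [h.halfEdgeMap_mulVec_add_single, hg']

end HalfEdgeMap

/-! ### The map at a vertex -/

section VertexMap

variable {Γ : RibbonGraph G D}

lemma differsAt_update [DecidableEq D] {a : Γ.State} {d : D} (h : a d = false) :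
    Γ.DiffersAt a (Function.update a d true) d :=
  ⟨by simp [h], fun _ hd' => Function.update_of_ne hd' _ _⟩

lemma PathChoice.vert_eq (p : Γ.PathChoice) (x : V(G)) (i : Fin 3) : Γ.vert (p x i) = x :=
  (p x i).2

lemma PathChoice.exists_eq (p : Γ.PathChoice) {x : V(G)} {d : D} (hd : Γ.vert d = x) :
    ∃ i, (p x i : D) = d :=
  ⟨(p x).symm ⟨d, hd⟩, by simp⟩

lemma PathChoice.coe_injective (p : Γ.PathChoice) (x : V(G)) :
    Function.Injective fun i => (p x i : D) :=
  Subtype.val_injective.comp (p x).injective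

/-- The coloring `g` of circles gives the same color to both sides of every half-edge at `x`. -/
def MonochromaticAt {α : Type*} {a : Γ.State} (g : Γ.Circle a → α) (x : V) : Prop :=
  ∀ d, Γ.vert d = x → MonochromaticAlong g d

variable [Finite D] {n : ℕ} [NeZero n] (p : Γ.PathChoice) {x : V(G)} {ν : Finset V}

lemma exists_vertexMap_eq (hx : (x : V) ∉ ν) :
    ∃ a₁ a₂ : Γ.State, Γ.DiffersAt (Γ.vertexState ν) a₁ (p x 0) ∧ Γ.DiffersAt a₁ a₂ (p x 1) ∧
      Γ.DiffersAt a₂ (Γ.vertexState (ν.cons x hx)) (p x 2) ∧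
      Γ.vertexMap p n x ν (ν.cons x hx) = Γ.halfEdgeMap n (p x 2) a₂ _ *
        Γ.halfEdgeMap n (p x 1) a₁ a₂ * Γ.halfEdgeMap n (p x 0) _ a₁ := by
  classical
  have h_ne {i j : Fin 3} (hij : i ≠ j) : (p x i : D) ≠ p x j := (p.coe_injective x).ne hij
  have h_before (i) : Γ.vertexState ν (p x i) = false := by simp [vertexState, p.vert_eq, hx]
  have h_after (i) : Γ.vertexState (ν.cons x hx) (p x i) = true := by
    simp [vertexState, p.vert_eq]
  refine ⟨Function.update (Γ.vertexState ν) (p x 0) true,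
    Function.update (Function.update (Γ.vertexState ν) (p x 0) true) (p x 1) true,
    differsAt_update (h_before 0), differsAt_update ?_, ⟨?_, fun d hd => ?_⟩, ?_⟩
  · rw [Function.update_of_ne (h_ne (i := 1) (j := 0) (by decide)), h_before]
  · rw [Function.update_of_ne (h_ne (by decide)), Function.update_of_ne (h_ne (by decide)),
      h_before, h_after, Bool.not_false]
  · by_cases hdx : Γ.vert d = x
    · obtain ⟨i, rfl⟩ := p.exists_eq hdx
      obtain rfl | rfl | rfl : i = 0 ∨ i = 1 ∨ i = 2 := by omega
      · rw [h_after, Function.update_of_ne (h_ne (by decide)), Function.update_self]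
      · rw [h_after, Function.update_self]
      · exact absurd rfl hd
    · have hdp (i) : d ≠ p x i := fun h => hdx (h ▸ p.vert_eq x i)
      rw [Function.update_of_ne (hdp 1), Function.update_of_ne (hdp 0)]
      simp [vertexState, hdx]
  · unfold vertexMap
    congr!

variable {g : Γ.Circle (Γ.vertexState ν) → ZMod n}

lemma vertexMap_mulVec_eq_zero (hx : (x : V) ∉ ν) (hg : ¬ MonochromaticAt g x) :
    Γ.vertexMap p n x ν (ν.cons x hx) *ᵥ coloringChar g = 0 := by
  obtain ⟨a₁, a₂, h₀, h₁, h₂, h_eq⟩ := exists_vertexMap_eq (n := n) p hx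
  simp only [h_eq, ← Matrix.mulVec_mulVec]
  by_cases hg₀ : MonochromaticAlong g (p x 0)
  swap
  · rw [h₀.halfEdgeMap_mulVec_eq_zero hg₀, Matrix.mulVec_zero, Matrix.mulVec_zero]
  obtain ⟨z₁, -, g₁, hg₁, h_map₁⟩ := h₀.exists_halfEdgeMap_mulVec_eq_smul hg₀
  rw [h_map₁, Matrix.mulVec_smul, Matrix.mulVec_smul]
  by_cases hg₀₁ : MonochromaticAlong g₁ (p x 1)
  swap
  · rw [h₁.halfEdgeMap_mulVec_eq_zero hg₀₁, Matrix.mulVec_zero, smul_zero]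
  obtain ⟨z₂, -, g₂, hg₂, h_map₂⟩ := h₁.exists_halfEdgeMap_mulVec_eq_smul hg₀₁
  rw [h_map₂, Matrix.mulVec_smul, h₂.halfEdgeMap_mulVec_eq_zero, smul_zero, smul_zero]
  rw [monochromaticAlong_congr hg₂, monochromaticAlong_congr hg₁]
  refine fun hg₂ => hg fun d hd => ?_
  obtain ⟨i, rfl⟩ := p.exists_eq hd
  obtain rfl | rfl | rfl : i = 0 ∨ i = 1 ∨ i = 2 := by omega
  exacts [hg₀, (monochromaticAlong_congr hg₁ _).1 hg₀₁, hg₂]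

lemma exists_vertexMap_mulVec_eq_smul (hx : (x : V) ∉ ν) (hg : MonochromaticAt g x) :
    ∃ z : ℂ, z ≠ 0 ∧ ∃ g' : Γ.Circle (Γ.vertexState (ν.cons x hx)) → ZMod n,
      (∀ s, g' (Γ.circle _ s) = g (Γ.circle _ s)) ∧
        Γ.vertexMap p n x ν (ν.cons x hx) *ᵥ coloringChar g = z • coloringChar g' := by
  obtain ⟨a₁, a₂, h₀, h₁, h₂, h_eq⟩ := exists_vertexMap_eq (n := n) p hx
  obtain ⟨z₁, hz₁, g₁, hg₁, h_map₁⟩ :=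
    h₀.exists_halfEdgeMap_mulVec_eq_smul (hg _ (p.vert_eq x 0))
  obtain ⟨z₂, hz₂, g₂, hg₂, h_map₂⟩ := h₁.exists_halfEdgeMap_mulVec_eq_smul
    ((monochromaticAlong_congr hg₁ _).2 (hg _ (p.vert_eq x 1)))
  obtain ⟨z₃, hz₃, g₃, hg₃, h_map₃⟩ := h₂.exists_halfEdgeMap_mulVec_eq_smul
    ((monochromaticAlong_congr hg₂ _).2 ((monochromaticAlong_congr hg₁ _).2
      (hg _ (p.vert_eq x 2))))
  refine ⟨z₁ * z₂ * z₃, mul_ne_zero (mul_ne_zero hz₁ hz₂) hz₃, g₃,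
    fun s => (hg₃ s).trans ((hg₂ s).trans (hg₁ s)), ?_⟩
  simp only [h_eq, ← Matrix.mulVec_mulVec, h_map₁, h_map₂, h_map₃, Matrix.mulVec_smul, smul_smul,
    mul_assoc]

lemma linearIndependent_vertexMap_mulVec (hx : (x : V) ∉ ν) :
    LinearIndependent ℂ fun g : {g : Γ.Circle (Γ.vertexState ν) → ZMod n // MonochromaticAt g x} =>
      Γ.vertexMap p n x ν (ν.cons x hx) *ᵥ coloringChar g.1 := by
  choose z hz g' hg' h_map using fun g : {g : Γ.Circle (Γ.vertexState ν) → ZMod n //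
    MonochromaticAt g x} => exists_vertexMap_mulVec_eq_smul p hx g.2
  have h_inj : g'.Injective := fun g₁ g₂ h => Subtype.ext <|
    (Γ.circle_surjective _).injective_comp_right <| funext fun s => by
      simp only [Function.comp_apply, ← hg', h]
  simp only [h_map]
  exact ((linearIndependent_coloringChar _ n).comp g' h_inj).units_smul fun g => Units.mk0 _ (hz g)

end VertexMap

/-! ### The homology in degree zero -/

section DegreeZero

variable {n : ℕ}

/-- In degree zero, where no vertex is `1`-smoothed, the generators of the complex are the monomials
of a single state. -/
def generatorZeroEquiv (Γ : RibbonGraph G D) (n : ℕ) :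
    Γ.Monomial n (Γ.vertexState ∅) ≃ Γ.Generator n 0 where
  toFun I := ⟨⟨∅, by simp⟩, I⟩
  invFun g := cast (by rw [Finset.card_eq_zero.1 (Int.natCast_eq_zero.1 g.1.2.2)]) g.2
  left_inv I := rfl
  right_inv := by
    rintro ⟨⟨ν, -, hν⟩, I⟩
    obtain rfl : ν = ∅ := Finset.card_eq_zero.1 (Int.natCast_eq_zero.1 hν)
    rfl

variable [Finite D] [NeZero n] {Γ : RibbonGraph G D} (p : Γ.PathChoice)

lemma iInf_ker_vertexMap_eq_span :
    ⨅ x : V(G), (Γ.vertexMap p n x ∅ {(x : V)}).mulVecLin.ker =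
      Submodule.span ℂ (coloringBasis (Γ.Circle (Γ.vertexState ∅)) n ''
        {g | ∀ x : V(G), ¬ MonochromaticAt g x}) := by
  refine iInf_ker_eq_span_image (coloringBasis (Γ.Circle (Γ.vertexState ∅)) n)
    (s := fun x : V(G) => {g | MonochromaticAt g x}) (fun x g hg => ?_) fun x => ?_
  · rw [coloringBasis_apply, Matrix.mulVecLin_apply]
    exact vertexMap_mulVec_eq_zero p (Finset.notMem_empty _) hg
  · simp only [LinearIndepOn, Function.comp_def, coloringBasis_apply, Matrix.mulVecLin_apply]
    exact linearIndependent_vertexMap_mulVec p (Finset.notMem_empty (x : V))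

variable [Fintype V] [LinearOrder V]

lemma differential_zero_apply (v : Γ.Chain n 0) (x : V(G))
    (J : Γ.Monomial n (Γ.vertexState {(x : V)})) :
    Γ.differential p n 0 (0 + 1) v ⟨⟨{(x : V)}, by simp⟩, J⟩ =
      (Γ.vertexMap p n x ∅ {(x : V)} *ᵥ (v ∘ Γ.generatorZeroEquiv n)) J := by
  classical
  let _ : Fintype (Γ.Generator n 0) := Fintype.ofFinite _
  simp only [differential, Matrix.mulVecLin_apply, Matrix.mulVec, dotProduct, Matrix.of_apply]
  rw [← Equiv.sum_comp (Γ.generatorZeroEquiv n)]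
  refine Finset.sum_congr rfl fun I _ => ?_
  rw [Finset.sum_eq_single x]
  · simp [generatorZeroEquiv]
  · intro y _ hyx
    rw [if_neg]
    rintro ⟨-, h⟩
    exact hyx (Subtype.ext (by simpa [generatorZeroEquiv, eq_comm] using h))
  · exact fun hx => absurd (Finset.mem_univ x) hx

lemma mem_ker_differential_zero_iff {v : Γ.Chain n 0} :
    v ∈ (Γ.differential p n 0 (0 + 1)).ker ↔ v ∘ Γ.generatorZeroEquiv n ∈
      ⨅ x : V(G), (Γ.vertexMap p n x ∅ {(x : V)}).mulVecLin.ker := by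
  simp only [Submodule.mem_iInf, LinearMap.mem_ker, Matrix.mulVecLin_apply]
  constructor
  · intro hv x
    funext J
    rw [← differential_zero_apply, hv]
    rfl
  · intro hv
    funext ⟨⟨ν, hνG, hν⟩, J⟩
    obtain ⟨x, rfl⟩ := Finset.card_eq_one.1 (Int.natCast_inj.1 hν)
    have hx : x ∈ V(G) := hνG (by simp)
    rw [differential_zero_apply p v ⟨x, hx⟩ J, hv]
    rfl

lemma finrank_filteredVertexHomology_zero_eq_finrank_ker :
    Module.finrank ℂ (Γ.FilteredVertexHomology p n 0) =
      Module.finrank ℂ (Γ.differential p n 0 (0 + 1)).ker := by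
  have h_empty : IsEmpty (Γ.Generator n (0 - 1)) := ⟨fun g => by
    have := g.1.2.2
    omega⟩
  have h_range : (Γ.differential p n (0 - 1) 0).range = ⊥ :=
    LinearMap.range_eq_bot.2 (Subsingleton.elim _ _)
  refine (Submodule.quotEquivOfEqBot _ ?_).finrank_eq
  rw [h_range, Submodule.submoduleOf, Submodule.comap_bot, Submodule.ker_subtype]

lemma finrank_ker_differential_zero :
    Module.finrank ℂ (Γ.differential p n 0 (0 + 1)).ker =
      Module.finrank ℂ ↥(⨅ x : V(G), (Γ.vertexMap p n x ∅ {(x : V)}).mulVecLin.ker) := by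
  let e : Γ.Chain n 0 ≃ₗ[ℂ] (Γ.Monomial n (Γ.vertexState ∅) → ℂ) :=
    LinearEquiv.funCongrLeft ℂ ℂ (Γ.generatorZeroEquiv n)
  have h_ker : (Γ.differential p n 0 (0 + 1)).ker.map (e : _ →ₗ[ℂ] _) =
      ⨅ x : V(G), (Γ.vertexMap p n x ∅ {(x : V)}).mulVecLin.ker := by
    ext v
    obtain ⟨v, rfl⟩ := e.surjective v
    rw [Submodule.mem_map_equiv, e.symm_apply_apply]
    exact mem_ker_differential_zero_iff p
  rw [← LinearEquiv.finrank_map_eq e, h_ker]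

theorem finrank_filteredVertexHomology_zero (Γ : RibbonGraph G D) (p : Γ.PathChoice) (n : ℕ)
    [NeZero n] : Module.finrank ℂ (Γ.FilteredVertexHomology p n 0) =
      Nat.card {g : Γ.Face → ZMod n // ∀ x : V(G), ¬ MonochromaticAt g x} := by
  have h_state : (fun _ => false : Γ.State) = Γ.vertexState ∅ := by
    funext d
    simp [vertexState]
  unfold Face
  rw [h_state, finrank_filteredVertexHomology_zero_eq_finrank_ker, finrank_ker_differential_zero,
    iInf_ker_vertexMap_eq_span, Set.image_eq_range]
  let _ := Fintype.ofFinite ↥{g : Γ.Circle (Γ.vertexState ∅) → ZMod n |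
    ∀ x : V(G), ¬ MonochromaticAt g x}
  exact (finrank_span_eq_card ((coloringBasis _ n).linearIndependent.comp _
    Subtype.val_injective)).trans Nat.card_eq_fintype_card.symm

end DegreeZero

/-! ### Cellular chains modulo two -/

section Cellular

variable {Γ : RibbonGraph G D}

lemma edge_mem (Γ : RibbonGraph G D) (d : D) : Γ.edge d ∈ E(G) :=
  (Γ.isLink d).edge_mem

lemma vert_mem (Γ : RibbonGraph G D) (d : D) : Γ.vert d ∈ V(G) :=
  (Γ.isLink d).left_mem

lemma vert_rot (Γ : RibbonGraph G D) (d : D) : Γ.vert (Γ.rot d) = Γ.vert d :=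
  (Γ.rot_sameCycle _ _).1 (Equiv.Perm.sameCycle_apply_left.2 (Equiv.Perm.SameCycle.refl _ _))

lemma finite_edgeSet [Finite D] (Γ : RibbonGraph G D) : Finite E(G) :=
  Finite.of_surjective (fun d => (⟨Γ.edge d, Γ.edge_mem d⟩ : E(G))) fun e =>
    (Γ.exists_edge e e.2).imp fun _ hd => Subtype.ext hd

lemma apply_eq_apply_of_forall_rot_of_forall_opp (hG : IsConnected G) {α : Type*} {f : D → α}
    (h_rot : ∀ d, f (Γ.rot d) = f d) (h_opp : ∀ d, f (Γ.opp d) = f d) (d d' : D) : f d = f d' := by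
  have h_zpow (m : ℤ) (d) : f ((Γ.rot ^ m) d) = f d := by
    induction m generalizing d with
    | zero => rfl
    | succ m ih => rw [zpow_add_one, Equiv.Perm.mul_apply, ih, h_rot]
    | pred m ih =>
      rw [zpow_sub_one, Equiv.Perm.mul_apply, ih, ← h_rot, ← Equiv.Perm.mul_apply, mul_inv_cancel,
        Equiv.Perm.one_apply]
  have h_vert (d) : f '' {d' | Γ.vert d' = Γ.vert d} = {f d} := by
    refine Set.eq_singleton_iff_unique_mem.2 ⟨⟨d, rfl, rfl⟩, ?_⟩
    rintro _ ⟨d', hd', rfl⟩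
    obtain ⟨m, rfl⟩ := (Γ.rot_sameCycle d d').2 hd'.symm
    exact h_zpow m d
  have h_const := hG.apply_eq_apply (f := fun x : V(G) => f '' {d' | Γ.vert d' = x}) ?_
    ⟨_, Γ.vert_mem d⟩ ⟨_, Γ.vert_mem d'⟩
  · rwa [h_vert, h_vert, Set.singleton_eq_singleton_iff] at h_const
  · rintro ⟨x, hx⟩ ⟨y, hy⟩ ⟨e, he⟩
    obtain ⟨d, rfl⟩ := Γ.exists_edge e he.edge_mem
    obtain ⟨rfl, rfl⟩ | ⟨rfl, rfl⟩ := (Γ.isLink d).eq_and_eq_or_eq_and_eq he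
    all_goals simp only [h_vert, h_opp]

/-- The difference of the colors on the two sides of a half-edge. -/
def sideDiff (g : Γ.Face → ZMod 2) (d : D) : ZMod 2 :=
  g (Γ.circle _ (d, true)) - g (Γ.circle _ (d, false))

lemma sideDiff_eq_zero_iff {g : Γ.Face → ZMod 2} {d : D} :
    sideDiff g d = 0 ↔ MonochromaticAlong g d :=
  sub_eq_zero.trans eq_comm

lemma sideDiff_opp (g : Γ.Face → ZMod 2) (d : D) : sideDiff g (Γ.opp d) = sideDiff g d := by
  have h_true := Γ.circle_across (fun _ => false) (d, true)
  have h_false := Γ.circle_across (fun _ => false) (d, false)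
  simp only [across] at h_true h_false
  rw [sideDiff, sideDiff, ← h_true, ← h_false]
  cases Γ.twisted (Γ.edge d)
  · exact (CharTwo.sub_eq_add _ _).trans ((add_comm _ _).trans (CharTwo.sub_eq_add _ _).symm)
  · rfl

/-- The cellular coboundary, modulo two and in terms of the dual cell structure, from colorings of
the faces to sets of edges: it consists of the edges across which the color changes. -/
def faceCoboundary (Γ : RibbonGraph G D) : (Γ.Face → ZMod 2) →ₗ[ZMod 2] (E(G) → ZMod 2) where
  toFun g e := sideDiff g (Γ.exists_edge e e.2).choose
  map_add' _ _ := funext fun _ => add_sub_add_comm _ _ _ _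
  map_smul' _ _ := funext fun _ => (mul_sub _ _ _).symm

lemma faceCoboundary_apply (g : Γ.Face → ZMod 2) (d : D) :
    Γ.faceCoboundary g ⟨Γ.edge d, Γ.edge_mem d⟩ = sideDiff g d := by
  obtain h | h := (Γ.edge_eq_iff _ _).1 (Γ.exists_edge _ (Γ.edge_mem d)).choose_spec.symm
  · exact congrArg (sideDiff g) h
  · exact (congrArg (sideDiff g) h).trans (sideDiff_opp g d)

lemma apply_eq_apply_of_forall_monochromaticAlong (hG : IsConnected G) {α : Type*} {g : Γ.Face → α}
    (hg : ∀ d, MonochromaticAlong g d) (F F' : Γ.Face) : g F = g F' := by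
  have h_side (d β) : g (Γ.circle _ (d, β)) = g (Γ.circle _ (d, false)) := by
    cases β
    exacts [rfl, (hg d).symm]
  have h_const := Γ.apply_eq_apply_of_forall_rot_of_forall_opp hG
    (f := fun d => g (Γ.circle _ (d, false)))
    (fun d => by rw [← circle_corner, h_side])
    (fun d => by rw [← Γ.circle_across _ (d, false)]; exact (h_side (Γ.opp d) _).symm)
  obtain ⟨⟨d, β⟩, rfl⟩ := Γ.circle_surjective _ F
  obtain ⟨⟨d', β'⟩, rfl⟩ := Γ.circle_surjective _ F'
  rw [h_side, h_side d', h_const]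

lemma mem_ker_faceCoboundary_iff {g : Γ.Face → ZMod 2} :
    g ∈ Γ.faceCoboundary.ker ↔ ∀ d, MonochromaticAlong g d := by
  refine ⟨fun hg d => ?_, fun hg => funext fun ⟨e, he⟩ => ?_⟩
  · rw [← sideDiff_eq_zero_iff, ← faceCoboundary_apply, LinearMap.mem_ker.1 hg, Pi.zero_apply]
  · obtain ⟨d, rfl⟩ := Γ.exists_edge e he
    rw [faceCoboundary_apply, sideDiff_eq_zero_iff.2 (hg d), Pi.zero_apply]

lemma finrank_ker_faceCoboundary_le_one [Finite D] (Γ : RibbonGraph G D) (hG : IsConnected G) :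
    Module.finrank (ZMod 2) Γ.faceCoboundary.ker ≤ 1 := by
  have h_le : Γ.faceCoboundary.ker ≤ ZMod 2 ∙ (1 : Γ.Face → ZMod 2) := by
    intro g hg
    have h_const := apply_eq_apply_of_forall_monochromaticAlong hG (mem_ker_faceCoboundary_iff.1 hg)
    cases isEmpty_or_nonempty Γ.Face with
    | inl _ => exact Subsingleton.elim 0 g ▸ zero_mem _
    | inr h =>
      obtain ⟨F⟩ := h
      exact Submodule.mem_span_singleton.2 ⟨g F, funext fun F' => by simp [h_const F F']⟩
  exact (Submodule.finrank_mono h_le).trans ((finrank_span_le_card _).trans (by simp))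

variable [Fintype D] [DecidableEq V]

/-- The cellular boundary, modulo two, from sets of edges to sets of vertices. Summing over
half-edges counts a loop twice at its vertex. -/
def edgeBoundary (Γ : RibbonGraph G D) : (E(G) → ZMod 2) →ₗ[ZMod 2] (V(G) → ZMod 2) where
  toFun u x := ∑ d with Γ.vert d = x, u ⟨Γ.edge d, Γ.edge_mem d⟩
  map_add' _ _ := funext fun _ => Finset.sum_add_distrib
  map_smul' _ _ := funext fun _ => (Finset.mul_sum _ _ _).symm

lemma edgeBoundary_apply (u : E(G) → ZMod 2) (x : V(G)) :
    Γ.edgeBoundary u x = ∑ d with Γ.vert d = x, u ⟨Γ.edge d, Γ.edge_mem d⟩ :=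
  rfl

lemma sum_sideDiff (g : Γ.Face → ZMod 2) (x : V) : ∑ d with Γ.vert d = x, sideDiff g d = 0 := by
  simp only [sideDiff, Finset.sum_sub_distrib, sub_eq_zero]
  exact Finset.sum_equiv Γ.rot (by simp [vert_rot]) fun d _ => by rw [circle_corner]

lemma range_faceCoboundary_le_ker_edgeBoundary (Γ : RibbonGraph G D) :
    Γ.faceCoboundary.range ≤ Γ.edgeBoundary.ker := by
  rintro _ ⟨g, rfl⟩
  funext x
  simp only [edgeBoundary_apply, faceCoboundary_apply]
  exact sum_sideDiff g x

lemma edgeBoundary_single [DecidableEq E] (Γ : RibbonGraph G D) (d : D) :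
    Γ.edgeBoundary (Pi.single ⟨Γ.edge d, Γ.edge_mem d⟩ 1) =
      Pi.single ⟨Γ.vert d, Γ.vert_mem d⟩ 1 + Pi.single ⟨Γ.vert (Γ.opp d), Γ.vert_mem _⟩ 1 := by
  classical
  have h_single (d') : (Pi.single ⟨Γ.edge d, Γ.edge_mem d⟩ 1 : E(G) → ZMod 2)
      ⟨Γ.edge d', Γ.edge_mem d'⟩ =
        (if d' = d then 1 else 0) + if d' = Γ.opp d then 1 else 0 := by
    simp only [Pi.single_apply, Subtype.mk.injEq, eq_comm (b := Γ.edge d), Γ.edge_eq_iff]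
    by_cases h : d' = d
    · simp [h, (Γ.opp_ne d).symm]
    · simp [h]
  funext x
  simp [edgeBoundary_apply, h_single, Finset.sum_add_distrib, Pi.single_apply,
    Subtype.ext_iff, eq_comm (a := (x : V))]

lemma card_vertexSet_le [Finite V] (Γ : RibbonGraph G D) (hG : IsConnected G) :
    Nat.card V(G) ≤ Module.finrank (ZMod 2) Γ.edgeBoundary.range + 1 := by
  classical
  let _ := Fintype.ofFinite V(G)
  let q (x : V(G)) : (V(G) → ZMod 2) ⧸ Γ.edgeBoundary.range :=
    Submodule.mkQ _ (Pi.single x 1)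
  have h_edge (d) : q ⟨Γ.vert d, Γ.vert_mem d⟩ = q ⟨Γ.vert (Γ.opp d), Γ.vert_mem _⟩ :=
    (Submodule.Quotient.eq _).2
      ⟨_, (Γ.edgeBoundary_single d).trans (ZModModule.sub_eq_add _ _).symm⟩
  obtain ⟨x, hx⟩ := hG.1
  have h_const (y) : q y = q ⟨x, hx⟩ := by
    refine hG.apply_eq_apply ?_ y _
    rintro ⟨y, hy⟩ ⟨z, hz⟩ ⟨e, he⟩
    obtain ⟨d, rfl⟩ := Γ.exists_edge e he.edge_mem
    obtain ⟨rfl, rfl⟩ | ⟨rfl, rfl⟩ := (Γ.isLink d).eq_and_eq_or_eq_and_eq he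
    exacts [h_edge d, (h_edge d).symm]
  have h_span : ZMod 2 ∙ q ⟨x, hx⟩ = ⊤ := by
    refine eq_top_iff.2 fun v _ => ?_
    obtain ⟨u, rfl⟩ := Submodule.Quotient.mk_surjective _ v
    rw [← Finset.univ_sum_single u, ← Submodule.mkQ_apply, map_sum]
    refine Submodule.sum_mem _ fun y _ => Submodule.mem_span_singleton.2 ⟨u y, ?_⟩
    rw [← h_const y, ← map_smul, ← Pi.single_smul', smul_eq_mul, mul_one]
  have h_quot : Module.finrank (ZMod 2) ((V(G) → ZMod 2) ⧸ Γ.edgeBoundary.range) ≤ 1 := by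
    rw [← finrank_top, ← h_span]
    exact (finrank_span_le_card _).trans (by simp)
  have h_add := Γ.edgeBoundary.range.finrank_quotient_add_finrank
  rw [Module.finrank_fintype_fun_eq_card, ← Nat.card_eq_fintype_card] at h_add
  omega

-- The Euler characteristic leaves no room for homology in degree one.
lemma IsPlane.range_faceCoboundary [Finite V] (hΓ : Γ.IsPlane) :
    Γ.faceCoboundary.range = Γ.edgeBoundary.ker := by
  have := Γ.finite_edgeSet
  let _ := Fintype.ofFinite E(G)
  obtain ⟨hG, hχ⟩ := hΓ
  refine Submodule.eq_of_le_of_finrank_le Γ.range_faceCoboundary_le_ker_edgeBoundary ?_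
  have h_face := Γ.finrank_ker_faceCoboundary_le_one hG
  have h_vert := Γ.card_vertexSet_le hG
  have h_coboundary := Γ.faceCoboundary.finrank_range_add_finrank_ker
  have h_boundary := Γ.edgeBoundary.finrank_range_add_finrank_ker
  rw [Module.finrank_fintype_fun_eq_card, ← Nat.card_eq_fintype_card] at h_coboundary h_boundary
  rw [← Nat.card_coe_set_eq, ← Nat.card_coe_set_eq] at hχ
  omega

end Cellular

/-! ### Colorings of the faces and perfect matchings -/

section Matching

variable {Γ : RibbonGraph G D}

lemma inc_iff (Γ : RibbonGraph G D) {e : E} {x : V} :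
    G.Inc e x ↔ ∃ d, Γ.vert d = x ∧ Γ.edge d = e := by
  constructor
  · intro h
    obtain ⟨d, rfl⟩ := Γ.exists_edge e h.edge_mem
    obtain rfl | rfl := h.eq_or_eq_of_isLink (Γ.isLink d)
    exacts [⟨d, rfl, rfl⟩, ⟨Γ.opp d, rfl, Γ.edge_opp d⟩]
  · rintro ⟨d, rfl, rfl⟩
    exact (Γ.isLink d).inc_left

lemma isLoopAt_edge_iff (Γ : RibbonGraph G D) {d : D} {x : V} :
    G.IsLoopAt (Γ.edge d) x ↔ Γ.vert d = x ∧ Γ.vert (Γ.opp d) = x := by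
  refine ⟨fun h => ⟨(h.eq_of_inc (Γ.isLink d).inc_left).symm,
    (h.eq_of_inc (Γ.isLink d).inc_right).symm⟩, ?_⟩
  rintro ⟨rfl, h⟩
  exact h ▸ Γ.isLink d

lemma isPerfectMatching_iff (Γ : RibbonGraph G D) {M : Set E} : IsPerfectMatching G M ↔
    M ⊆ E(G) ∧ ∀ x : V(G), ∃! d, Γ.vert d = x ∧ Γ.edge d ∈ M := by
  refine ⟨fun ⟨hM, h⟩ => ⟨fun e he => (hM e he).1, fun ⟨x, hx⟩ => ?_⟩,
    fun ⟨hM, h⟩ => ⟨fun e he => ⟨hM he, fun x hx => ?_⟩, fun x hx => ?_⟩⟩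
  · obtain ⟨e, ⟨he, hex⟩, h_unique⟩ := h x hx
    obtain ⟨d, hd, rfl⟩ := Γ.inc_iff.1 hex
    refine ⟨d, ⟨hd, he⟩, fun d' ⟨hd', he'⟩ => ?_⟩
    have h_edge := h_unique _ ⟨he', Γ.inc_iff.2 ⟨d', hd', rfl⟩⟩
    refine ((Γ.edge_eq_iff d d').1 h_edge.symm).resolve_right fun h_opp => ?_
    exact (hM _ he).2 x (Γ.isLoopAt_edge_iff.2 ⟨hd, h_opp ▸ hd'⟩)
  · obtain ⟨d, rfl⟩ := Γ.exists_edge e (hM he)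
    obtain ⟨hd, hd'⟩ := Γ.isLoopAt_edge_iff.1 hx
    exact Γ.opp_ne d ((h ⟨x, hx.vertex_mem⟩).unique ⟨hd', (Γ.edge_opp d).symm ▸ he⟩ ⟨hd, he⟩)
  · obtain ⟨d, ⟨hd, he⟩, h_unique⟩ := h ⟨x, hx⟩
    refine ⟨Γ.edge d, ⟨he, Γ.inc_iff.2 ⟨d, hd, rfl⟩⟩, fun e ⟨he', hex⟩ => ?_⟩
    obtain ⟨d', hd', rfl⟩ := Γ.inc_iff.1 hex
    rw [h_unique d' ⟨hd', he'⟩]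

lemma PathChoice.existsUnique_iff (p : Γ.PathChoice) (x : V(G)) {P : D → Prop} :
    (∃! d, Γ.vert d = x ∧ P d) ↔ ∃! i, P (p x i) := by
  constructor
  · rintro ⟨d, ⟨hd, hP⟩, h_unique⟩
    obtain ⟨i, rfl⟩ := p.exists_eq hd
    exact ⟨i, hP, fun j hj => p.coe_injective x (h_unique _ ⟨p.vert_eq x j, hj⟩)⟩
  · rintro ⟨i, hP, h_unique⟩
    refine ⟨p x i, ⟨p.vert_eq x i, hP⟩, fun d ⟨hd, hd'⟩ => ?_⟩
    obtain ⟨j, rfl⟩ := p.exists_eq hd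
    rw [h_unique j hd']

lemma PathChoice.not_monochromaticAt_iff (p : Γ.PathChoice) {x : V(G)} {g : Γ.Face → ZMod 2} :
    ¬ MonochromaticAt g x ↔ ∃ i, sideDiff g (p x i) ≠ 0 := by
  simp only [MonochromaticAt, ne_eq, sideDiff_eq_zero_iff, not_forall]
  refine ⟨fun ⟨d, hd, h⟩ => ?_, fun ⟨i, h⟩ => ⟨_, p.vert_eq x i, h⟩⟩
  obtain ⟨i, rfl⟩ := p.exists_eq hd
  exact ⟨i, h⟩

/-- The set of edges with the same color on both sides. -/
def monochromaticEdges {α : Type*} (g : Γ.Face → α) : Set E :=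
  {e | ∃ d, Γ.edge d = e ∧ MonochromaticAlong g d}

lemma monochromaticEdges_subset {α : Type*} (g : Γ.Face → α) : monochromaticEdges g ⊆ E(G) := by
  rintro _ ⟨d, rfl, -⟩
  exact Γ.edge_mem d

lemma edge_mem_monochromaticEdges {g : Γ.Face → ZMod 2} {d : D} :
    Γ.edge d ∈ monochromaticEdges g ↔ sideDiff g d = 0 := by
  simp only [monochromaticEdges, ← sideDiff_eq_zero_iff]
  refine ⟨fun ⟨d', h_edge, h⟩ => ?_, fun h => ⟨d, rfl, h⟩⟩
  obtain rfl | rfl := (Γ.edge_eq_iff _ _).1 h_edge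
  exacts [h, (sideDiff_opp g d').trans h]

lemma sum_eq_zero_and_exists_ne_zero_iff (w : Fin 3 → ZMod 2) :
    (∑ i, w i = 0 ∧ ∃ i, w i ≠ 0) ↔ ∃! i, w i = 0 := by
  revert w
  unfold ExistsUnique
  decide

lemma PathChoice.sum_eq [Fintype D] [DecidableEq V] (p : Γ.PathChoice) (x : V(G))
    {A : Type*} [AddCommMonoid A] (f : D → A) :
    ∑ d with Γ.vert d = x, f d = ∑ i, f (p x i) := by
  rw [Finset.sum_subtype (p := fun d => Γ.vert d = x) _ (by simp), ← Equiv.sum_comp (p x)]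

lemma isPerfectMatching_monochromaticEdges_iff [Finite D] (p : Γ.PathChoice)
    (g : Γ.Face → ZMod 2) : IsPerfectMatching G (monochromaticEdges g) ↔
      ∀ x : V(G), ¬ MonochromaticAt g x := by
  classical
  let _ := Fintype.ofFinite D
  rw [Γ.isPerfectMatching_iff, and_iff_right (monochromaticEdges_subset g)]
  refine forall_congr' fun x => ?_
  have h_sum : ∑ i, sideDiff g (p x i) = 0 := (p.sum_eq x _).symm.trans (sum_sideDiff g x)
  simp only [p.existsUnique_iff, edge_mem_monochromaticEdges, p.not_monochromaticAt_iff]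
  rw [← sum_eq_zero_and_exists_ne_zero_iff, and_iff_right h_sum]

lemma IsPlane.exists_monochromaticEdges_eq [Finite V] [Finite D] (hΓ : Γ.IsPlane)
    (p : Γ.PathChoice) {M : Set E} (hM : IsPerfectMatching G M) :
    ∃ g : Γ.Face → ZMod 2, monochromaticEdges g = M := by
  classical
  let _ := Fintype.ofFinite D
  obtain ⟨h_subset, h_unique⟩ := Γ.isPerfectMatching_iff.1 hM
  obtain ⟨g, hg⟩ : (fun e : E(G) => if (e : E) ∈ M then (0 : ZMod 2) else 1) ∈
      Γ.faceCoboundary.range := by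
    rw [hΓ.range_faceCoboundary]
    funext x
    rw [edgeBoundary_apply, p.sum_eq]
    refine ((sum_eq_zero_and_exists_ne_zero_iff _).2 ?_).1
    simpa using (p.existsUnique_iff x).1 (h_unique x)
  refine ⟨g, Set.ext fun e => ?_⟩
  by_cases he : e ∈ E(G)
  · obtain ⟨d, rfl⟩ := Γ.exists_edge e he
    rw [edge_mem_monochromaticEdges, ← faceCoboundary_apply, hg]
    simp
  · exact iff_of_false (fun h => he (monochromaticEdges_subset g h)) fun h => he (h_subset h)

lemma eq_of_monochromaticEdges_eq (hG : IsConnected G) {g g' : Γ.Face → ZMod 2}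
    (h_edges : monochromaticEdges g = monochromaticEdges g') {F : Γ.Face} (hF : g F = g' F) :
    g = g' := by
  have h_side (d) : sideDiff g d = sideDiff g' d := by
    have h_zero : sideDiff g d = 0 ↔ sideDiff g' d = 0 := by
      rw [← edge_mem_monochromaticEdges, h_edges, edge_mem_monochromaticEdges]
    generalize sideDiff g d = c, sideDiff g' d = c' at h_zero ⊢
    revert c c'
    decide
  have h_mono (d) : MonochromaticAlong (g - g') d :=
    sideDiff_eq_zero_iff.1 <| (sub_sub_sub_comm _ _ _ _).trans (sub_eq_zero.2 (h_side d))
  funext F'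
  have h_const := apply_eq_apply_of_forall_monochromaticAlong hG h_mono F' F
  rwa [Pi.sub_apply, Pi.sub_apply, hF, sub_self, sub_eq_zero] at h_const

lemma monochromaticEdges_add_const {g : Γ.Face → ZMod 2} (c : ZMod 2) :
    monochromaticEdges (fun F => g F + c) = monochromaticEdges g := by
  simp only [monochromaticEdges, MonochromaticAlong, add_left_inj]

theorem IsPlane.card_colorings [Finite V] [Finite D] (hΓ : Γ.IsPlane) (p : Γ.PathChoice) :
    Nat.card {g : Γ.Face → ZMod 2 // ∀ x : V(G), ¬ MonochromaticAt g x} =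
      2 * {M : Set E | IsPerfectMatching G M}.ncard := by
  obtain ⟨x, hx⟩ := hΓ.1.1
  let F : Γ.Face := Γ.circle _ (p ⟨x, hx⟩ 0, true)
  let φ (g : {g : Γ.Face → ZMod 2 // ∀ x : V(G), ¬ MonochromaticAt g x}) :
      ZMod 2 × {M : Set E | IsPerfectMatching G M} :=
    (g.1 F, ⟨monochromaticEdges g.1, (isPerfectMatching_monochromaticEdges_iff p g.1).2 g.2⟩)
  have h_injective : φ.Injective := fun g g' h => Subtype.ext <|
    eq_of_monochromaticEdges_eq hΓ.1 (congrArg (fun y => y.2.1) h) (congrArg Prod.fst h)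
  have h_surjective : φ.Surjective := by
    rintro ⟨c, M, hM⟩
    obtain ⟨g, rfl⟩ := hΓ.exists_monochromaticEdges_eq p hM
    have h_edges := monochromaticEdges_add_const (g := g) (c - g F)
    refine ⟨⟨_, (isPerfectMatching_monochromaticEdges_iff p _).1 (h_edges.symm ▸ hM)⟩, ?_⟩
    exact Prod.ext (add_sub_cancel _ _) (Subtype.ext h_edges)
  rw [Nat.card_congr (Equiv.ofBijective φ ⟨h_injective, h_surjective⟩), Nat.card_prod,
    Nat.card_zmod, Nat.card_coe_set_eq]

end Matching

end RibbonGraph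

end VertexHomology

end

theorem theorem2 {V E D : Type*} [Fintype V] [LinearOrder V] [Finite D] (G : Graph V E)
    (hconn : VertexHomology.IsConnected G) (htri : VertexHomology.IsTrivalent G)
    (Γ : VertexHomology.RibbonGraph G D) (hΓ : Γ.IsPlane) (p : Γ.PathChoice) :
    Module.finrank ℂ (Γ.FilteredVertexHomology p 2 0) =
      2 * {M : Set E | VertexHomology.IsPerfectMatching G M}.ncard := by
  rw [Γ.finrank_filteredVertexHomology_zero p 2, hΓ.card_colorings p]
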